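/- Let $G$ be a finite simple graph. For positive integers $w,d$, a finite collection $A_1,\dots,A_n$ of subsets of $V(G)$ is a $(w,d)$-covering of $G$ if for every edge $uv$ of $G$ and every $w$-subset $W\subseteq V(G)\setminus\{u,v\}$ there are at least $d$ indices $j$ with $\{u,v\}\subseteq A_j$ and $W\cap A_j=\varnothing$. Let $N(G,w;d)$ be the least number $n$ of sets in a $(w,d)$-covering of $G$, and let $N(G)=N(G,1;1)$. 1. For every finite simple graph $G$ with $m\ge 1$ edges, $$\frac{2}{1+\log_2 e}\,\log_2 m\le N(G).$$ 2. There is an absolute constant $C$ such that for every finite simple graph $G$ with $m\ge 1$ edges, $$\frac{1}{\log 1.25}\,\log m\le N(G,2;1)+C.$$ In particular, the bound $\frac{1}{\log 1.25}\log m\le(1+o(1))N(G,2;1)$ holds as $m\to\infty$. 3. There is an absolute constant $c>0$ such that for every integer $w\ge 2$ and every finite simple graph $G$ with $m>\binom{w+1}{2}$ edges, $$c\,\frac{w^2}{\log w}\,\log m\le N(G,w;1).$$ -/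

import Mathlib

universe u

/-- A finite collection `A 0, …, A (n - 1)` of sets of vertices is a `(w, d)`-covering of `G` if for
every edge `uv` and every `w`-set `W` of vertices disjoint from `{u, v}` there are at least `d`
members of the collection that contain both `u` and `v` and are disjoint from `W`. -/
def IsCovering {V : Type u} (G : SimpleGraph V) (w d : ℕ) {n : ℕ} (A : Fin n → Set V) : Prop :=
  ∀ u v : V, G.Adj u v → ∀ W : Finset V, W.card = w → u ∉ W → v ∉ W →
    d ≤ {j : Fin n | u ∈ A j ∧ v ∈ A j ∧ ∀ x ∈ W, x ∉ A j}.ncard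

/-- The key pool number `N(G, w; d)`: the least number of sets in a `(w, d)`-covering of `G`. -/
noncomputable def keyPoolNumber {V : Type u} (G : SimpleGraph V) (w d : ℕ) : ℕ :=
  sInf {n : ℕ | ∃ A : Fin n → Set V, IsCovering G w d A}

/-- Coverings of a finite graph exist: take every set of vertices `d` times. -/
theorem exists_isCovering {V : Type u} [Finite V] (G : SimpleGraph V) (w d : ℕ) :
    ∃ n : ℕ, ∃ A : Fin n → Set V, IsCovering G w d A := by
  classical
  obtain ⟨n, ⟨e⟩⟩ := Finite.exists_equiv_fin (Fin d × Set V)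
  refine ⟨n, fun j => (e.symm j).2, ?_⟩
  intro u v _ W _ hu hv
  have hinj : Function.Injective (fun i : Fin d => e (i, ({u, v} : Set V))) := by
    intro i j h
    simpa using h
  have hcard : (Set.range (fun i : Fin d => e (i, ({u, v} : Set V)))).ncard = d := by
    rw [← Set.image_univ, Set.ncard_image_of_injective _ hinj, Set.ncard_univ, Nat.card_fin]
  calc d = _ := hcard.symm
    _ ≤ _ := Set.ncard_le_ncard (by
      rintro _ ⟨i, rfl⟩
      simp only [Set.mem_ofPred_eq, Equiv.symm_apply_apply]
      refine ⟨by simp, by simp, ?_⟩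
      rintro x hx (rfl | rfl)
      · exact hu hx
      · exact hv hx) (Set.toFinite _)

/-- The minimum that defines the key pool number is attained. -/
theorem keyPoolNumber_spec {V : Type u} [Finite V] (G : SimpleGraph V) (w d : ℕ) :
    ∃ A : Fin (keyPoolNumber G w d) → Set V, IsCovering G w d A :=
  Nat.sInf_mem (s := {n : ℕ | ∃ A : Fin n → Set V, IsCovering G w d A}) (exists_isCovering G w d)

/-!
Given a covering `A 0, …, A (n - 1)`, assign to every edge `e` the set `S e` of the indices `j` for
which `A j` contains both ends of `e`. An edge `f` different from `e` has an end `x`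
outside `e`, and an index of `S f` is the index of a set containing `x`. Choosing one such
end for each of at most `w` edges different from `e`, one sees that a `(w, 1)`-covering makes
`e ↦ S e` a `w`-cover-free family: no `S e` lies in the union of `w` others
(`IsCovering.isCoverFree`). The choice needs `w + 2` vertices, which are there as soon as
`m > (w + 1).choose 2`. All three parts are then upper bounds for the number `m` of members of a
cover-free family of subsets of an `n`-set.

* A `1`-cover-free family is injective, so `m ≤ 2 ^ n`.
* For a `2`-cover-free family, call a subset of `S e` *own* if no other member contains it. Of two
  complementary subsets of `S e` one is own. After a dummy point has been added to the sets of odd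
  size, every `S e` has an even size `2 t`, and at least half of its `t`-subsets are own. All these
  own sets, for all `e` and all `t`, form an antichain. The LYM inequality, together with
  `4 ^ n * n.choose t ≤ 5 ^ n * t.centralBinom`, gives `m ≤ 5 / 2 * (5 / 4) ^ n`, without any loss
  that is polynomial in `n`.
* For a `w`-cover-free family, Füredi's argument is used: members without own subsets of size at
  most `t` have large differences, so that any `w + 1` of them cover more than
  `t * (w + 1).choose 2` points. For `t` slightly larger than `2 n / w ^ 2`, there are thus at most
  `w` such members, and the others inject into the subsets of size at most `t`.
-/

open Finset

section CoverFree

variable {ι α : Type*}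

/-! ### The number of small subsets -/

theorem card_filter_card_le_one [Fintype α] :
    #{T : Finset α | #T ≤ 1} ≤ Fintype.card α + 1 := by
  rw [← Fintype.card_option, ← card_univ]
  refine card_le_card_of_surjOn Option.toFinset fun T hT => ?_
  simp only [coe_filter, mem_univ, true_and, Set.mem_ofPred_eq] at hT
  rcases Nat.le_one_iff_eq_zero_or_eq_one.1 hT with h | h
  · exact ⟨none, by simp, (card_eq_zero.1 h).symm⟩
  · obtain ⟨a, rfl⟩ := card_eq_one.1 h
    exact ⟨some a, by simp, rfl⟩

/-- The weight `x⁻¹ ^ #T` of a set with `#T ≤ t` is at least `x⁻¹ ^ t`, and the weights of all sets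
add up to `(1 + x⁻¹) ^ n`. -/
theorem card_filter_card_le [Fintype α] {x : ℝ} (hx : 1 ≤ x) (t : ℕ) :
    (#{T : Finset α | #T ≤ t} : ℝ) ≤ x ^ t * (1 + x⁻¹) ^ Fintype.card α := by
  have hx0 : 0 < x := by linarith
  have hsum := Finset.sum_pow_mul_eq_add_pow x⁻¹ 1 (univ : Finset α)
  simp only [one_pow, mul_one, powerset_univ, card_univ] at hsum
  rw [add_comm 1, ← hsum, mul_sum, card_eq_sum_ones, Nat.cast_sum]
  refine (sum_le_sum fun T hT => ?_).trans
    (sum_le_sum_of_subset_of_nonneg (filter_subset _ _) fun T _ _ => by positivity)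
  rw [inv_pow, ← div_eq_mul_inv, Nat.cast_one, one_le_div (by positivity)]
  exact pow_le_pow_right₀ hx (by simpa using hT)

/-! ### Cover-free families -/

/-- A subset of the member `S e` is own if it is contained in no member with another index. -/
def IsOwn (S : ι → Finset α) (e : ι) (T : Finset α) : Prop :=
  T ⊆ S e ∧ ∀ f, f ≠ e → ¬ T ⊆ S f

/-- In particular, a set is an own subset of at most one member. -/
theorem IsOwn.eq_of_subset {S : ι → Finset α} {e f : ι} {T U : Finset α} (hT : IsOwn S e T)
    (hU : IsOwn S f U) (h : T ⊆ U) : e = f := by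
  by_contra hne
  exact hT.2 f (Ne.symm hne) (h.trans hU.1)

variable [DecidableEq α]

/-- A family of finite sets, indexed by `ι`, is `r`-cover-free if no member is contained in the
union of at most `r` members with other indices. -/
def IsCoverFree (r : ℕ) (S : ι → Finset α) : Prop :=
  ∀ e, ∀ P : Finset ι, e ∉ P → #P ≤ r → ¬ S e ⊆ P.biUnion S

theorem IsCoverFree.injective {r : ℕ} {S : ι → Finset α} (hr : 1 ≤ r) (hS : IsCoverFree r S) :
    Function.Injective S := by
  intro e f h
  by_contra hne
  refine hS e {f} (by simpa using hne) (by simpa using hr) ?_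
  simp [h]

theorem IsCoverFree.card_le_two_pow [Fintype ι] [Fintype α] {r : ℕ} {S : ι → Finset α}
    (hr : 1 ≤ r) (hS : IsCoverFree r S) : Fintype.card ι ≤ 2 ^ Fintype.card α := by
  simpa using Fintype.card_le_of_injective S (hS.injective hr)

/-! ### An inequality between binomial coefficients -/

theorem four_pow_mul_choose_five_mul_le (t : ℕ) :
    4 ^ (5 * t) * (5 * t).choose t ≤ 5 ^ (5 * t) * t.centralBinom := by
  induction t with
  | zero => simp
  | succ t ih =>
    have h0 := Nat.add_one_mul_choose_eq (5 * t + 4) t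
    have h1 := Nat.choose_mul_succ_eq (5 * t) t
    have h2 := Nat.choose_mul_succ_eq (5 * t + 1) t
    have h3 := Nat.choose_mul_succ_eq (5 * t + 2) t
    have h4 := Nat.choose_mul_succ_eq (5 * t + 3) t
    have hb := Nat.succ_mul_centralBinom_succ t
    rw [show 5 * t + 1 - t = 4 * t + 1 by omega] at h1
    rw [show 5 * t + 1 + 1 - t = 4 * t + 2 by omega] at h2
    rw [show 5 * t + 2 + 1 - t = 4 * t + 3 by omega] at h3
    rw [show 5 * t + 3 + 1 - t = 4 * t + 4 by omega] at h4
    rw [show 5 * (t + 1) = 5 * t + 4 + 1 by ring]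
    have h0' : (5 * t + 4 + 1).choose (t + 1) = 5 * (5 * t + 4).choose t := by
      apply Nat.eq_of_mul_eq_mul_right (Nat.succ_pos t)
      rw [Nat.succ_eq_add_one, ← h0]
      ring
    set D := (4 * t + 4) * (4 * t + 3) * (4 * t + 2) * (4 * t + 1) with hD
    set P := (5 * t + 4) * (5 * t + 3) * (5 * t + 2) * (5 * t + 1) with hP
    have hC : (5 * t + 4).choose t * D = P * (5 * t).choose t := by
      calc (5 * t + 4).choose t * D
          = ((5 * t + 3 + 1).choose t * (4 * t + 4)) * (4 * t + 3) * (4 * t + 2) * (4 * t + 1) := by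
            rw [hD]; ring
        _ = (5 * t + 4) * ((5 * t + 2 + 1).choose t * (4 * t + 3)) * (4 * t + 2) * (4 * t + 1) := by
            rw [← h4]; ring
        _ = (5 * t + 4) * (5 * t + 3) * ((5 * t + 1 + 1).choose t * (4 * t + 2)) *
              (4 * t + 1) := by
            rw [← h3]; ring
        _ = (5 * t + 4) * (5 * t + 3) * (5 * t + 2) * ((5 * t + 1).choose t * (4 * t + 1)) := by
            rw [← h2]; ring
        _ = P * (5 * t).choose t := by rw [← h1, hP]; ring
    have hB : D * (t + 1).centralBinom =
        8 * ((4 * t + 3) * (4 * t + 2) * (4 * t + 1) * (2 * t + 1)) * t.centralBinom := by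
      calc D * (t + 1).centralBinom
          = 4 * ((4 * t + 3) * (4 * t + 2) * (4 * t + 1)) * ((t + 1) * (t + 1).centralBinom) := by
            rw [hD]; ring
        _ = _ := by rw [hb]; ring
    -- The two quartics agree in their coefficients of degree four and three.
    have hpoly : 4 ^ 5 * 5 * P ≤
        5 ^ 5 * (8 * ((4 * t + 3) * (4 * t + 2) * (4 * t + 1) * (2 * t + 1))) := by
      rw [hP]
      ring_nf
      gcongr <;> norm_num
    have hDpos : 0 < D := by positivity
    refine Nat.le_of_mul_le_mul_left ?_ hDpos
    calc D * (4 ^ (5 * t + 4 + 1) * (5 * t + 4 + 1).choose (t + 1))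
        = 4 ^ 5 * 5 * 4 ^ (5 * t) * ((5 * t + 4).choose t * D) := by rw [h0']; ring
      _ = 4 ^ 5 * 5 * P * (4 ^ (5 * t) * (5 * t).choose t) := by rw [hC]; ring
      _ ≤ 5 ^ 5 * (8 * ((4 * t + 3) * (4 * t + 2) * (4 * t + 1) * (2 * t + 1))) *
            (5 ^ (5 * t) * t.centralBinom) := Nat.mul_le_mul hpoly ih
      _ = 5 ^ 5 * 5 ^ (5 * t) * (D * (t + 1).centralBinom) := by rw [hB]; ring
      _ = D * (5 ^ (5 * t + 4 + 1) * (t + 1).centralBinom) := by ring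

/-- For fixed `t`, the quotient `4 ^ n * n.choose t / 5 ^ n` is largest at `n = 5 * t`. -/
theorem four_pow_mul_choose_le (n t : ℕ) :
    4 ^ n * n.choose t ≤ 5 ^ n * t.centralBinom := by
  rcases le_total (5 * t) n with h | h
  · induction n, h using Nat.le_induction with
    | base => exact four_pow_mul_choose_five_mul_le t
    | succ n hn ih =>
      have h1 := Nat.choose_mul_succ_eq n t
      have h2 : 4 * (n + 1).choose t ≤ 5 * n.choose t := by
        refine Nat.le_of_mul_le_mul_right (c := n + 1 - t) ?_ (by omega)
        calc 4 * (n + 1).choose t * (n + 1 - t) = n.choose t * (4 * (n + 1)) := by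
              rw [mul_assoc, ← h1]; ring
          _ ≤ n.choose t * (5 * (n + 1 - t)) := Nat.mul_le_mul_left _ (by omega)
          _ = _ := by ring
      calc 4 ^ (n + 1) * (n + 1).choose t = 4 ^ n * (4 * (n + 1).choose t) := by ring
        _ ≤ 4 ^ n * (5 * n.choose t) := Nat.mul_le_mul_left _ h2
        _ = 5 * (4 ^ n * n.choose t) := by ring
        _ ≤ 5 * (5 ^ n * t.centralBinom) := Nat.mul_le_mul_left _ ih
        _ = _ := by ring
  · induction h using Nat.decreasingInduction with
    | self => exact four_pow_mul_choose_five_mul_le t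
    | of_succ n hn ih =>
      have h1 := Nat.choose_mul_succ_eq n t
      have h2 : 5 * n.choose t ≤ 4 * (n + 1).choose t := by
        refine Nat.le_of_mul_le_mul_right (c := n + 1) ?_ (by omega)
        calc 5 * n.choose t * (n + 1) = (n + 1).choose t * (5 * (n + 1 - t)) := by
              rw [mul_assoc, h1]; ring
          _ ≤ (n + 1).choose t * (4 * (n + 1)) := Nat.mul_le_mul_left _ (by omega)
          _ = _ := by ring
      refine Nat.le_of_mul_le_mul_left (c := 5) ?_ (by norm_num)
      calc 5 * (4 ^ n * n.choose t) = 4 ^ n * (5 * n.choose t) := by ring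
        _ ≤ 4 ^ n * (4 * (n + 1).choose t) := Nat.mul_le_mul_left _ h2
        _ = 4 ^ (n + 1) * (n + 1).choose t := by ring
        _ ≤ 5 ^ (n + 1) * t.centralBinom := ih
        _ = _ := by ring

/-! ### Families in which no set is covered by two others -/

theorem IsCoverFree.isOwn_or_isOwn_sdiff {S : ι → Finset α} (hS : IsCoverFree 2 S) {e : ι}
    {T : Finset α} (hT : T ⊆ S e) : IsOwn S e T ∨ IsOwn S e (S e \ T) := by
  classical
  by_contra! h
  obtain ⟨h1, h2⟩ := h
  simp only [IsOwn, hT, true_and, sdiff_subset, not_forall, not_not] at h1 h2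
  obtain ⟨f, hf, hTf⟩ := h1
  obtain ⟨g, hg, hTg⟩ := h2
  refine hS e {f, g} (by simp [hf.symm, hg.symm]) card_le_two fun x hx => ?_
  by_cases hxT : x ∈ T
  · exact mem_biUnion.2 ⟨f, by simp, hTf hxT⟩
  · exact mem_biUnion.2 ⟨g, by simp, hTg (mem_sdiff.2 ⟨hx, hxT⟩)⟩

open Classical in
/-- The complement in `S e` maps the `t`-subsets that are not own to own ones. -/
theorem IsCoverFree.centralBinom_le {S : ι → Finset α} (hS : IsCoverFree 2 S) {e : ι} {t : ℕ}
    (ht : #(S e) = 2 * t) :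
    t.centralBinom ≤ 2 * #{T ∈ (S e).powersetCard t | IsOwn S e T} := by
  have h1 : #((S e).powersetCard t) = t.centralBinom := by
    rw [card_powersetCard, ht, Nat.centralBinom_eq_two_mul_choose]
  have h2 : #{T ∈ (S e).powersetCard t | ¬ IsOwn S e T} ≤
      #{T ∈ (S e).powersetCard t | IsOwn S e T} := by
    refine card_le_card_of_injOn (fun T => S e \ T) ?_ ?_
    · intro T hT
      simp only [coe_filter, mem_powersetCard, Set.mem_ofPred_eq] at hT ⊢
      obtain ⟨⟨hTs, hTt⟩, hT⟩ := hT
      refine ⟨⟨sdiff_subset, ?_⟩, (hS.isOwn_or_isOwn_sdiff hTs).resolve_left hT⟩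
      rw [card_sdiff_of_subset hTs]
      omega
    · intro T hT U hU h
      simp only [coe_filter, mem_powersetCard, Set.mem_ofPred_eq] at hT hU
      have h' : S e \ T = S e \ U := h
      rw [← Finset.sdiff_sdiff_eq_self hT.1.1, h', Finset.sdiff_sdiff_eq_self hU.1.1]
  have h3 := card_filter_add_card_filter_not (s := (S e).powersetCard t) (fun T => IsOwn S e T)
  omega

theorem IsCoverFree.card_mul_four_pow_le_of_even [Fintype ι] [Fintype α] {S : ι → Finset α}
    (hS : IsCoverFree 2 S) (heven : ∀ e, Even #(S e)) :
    Fintype.card ι * 4 ^ Fintype.card α ≤ 2 * 5 ^ Fintype.card α := by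
  classical
  set N := Fintype.card α with hN
  choose t ht using fun e => (heven e).exists_two_nsmul
  simp only [smul_eq_mul] at ht
  set own : ι → Finset (Finset α) := fun e => {T ∈ (S e).powersetCard (t e) | IsOwn S e T} with hown
  have mem_own : ∀ {e T}, T ∈ own e ↔ (T ⊆ S e ∧ #T = t e) ∧ IsOwn S e T := by
    intro e T
    simp [hown]
  have hdisj : ((univ : Finset ι) : Set ι).PairwiseDisjoint own := by
    intro e _ f _ hne
    refine disjoint_left.2 fun T hT hT' => hne ?_
    exact (mem_own.1 hT).2.eq_of_subset (mem_own.1 hT').2 subset_rfl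
  have hanti : IsAntichain (· ⊆ ·) ((univ.biUnion own : Finset (Finset α)) : Set (Finset α)) := by
    intro T hT U hU hne hsub
    simp only [coe_biUnion, coe_univ, Set.mem_univ, Set.iUnion_true, Set.mem_iUnion,
      mem_coe] at hT hU
    obtain ⟨e, hT⟩ := hT
    obtain ⟨f, hU⟩ := hU
    rw [mem_own] at hT hU
    obtain rfl := hT.2.eq_of_subset hU.2 hsub
    exact hne (eq_of_subset_of_card_le hsub (by rw [hT.1.2, hU.1.2]))
  have hlym := lubell_yamamoto_meshalkin_inequality_sum_inv_choose (𝕜 := ℝ) hanti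
  rw [sum_biUnion hdisj, ← hN] at hlym
  have hterm : ∀ e, (4 / 5 : ℝ) ^ N / 2 ≤ ∑ T ∈ own e, ((N.choose #T : ℕ) : ℝ)⁻¹ := by
    intro e
    have hsum : ∑ T ∈ own e, ((N.choose #T : ℕ) : ℝ)⁻¹ = #(own e) * ((N.choose (t e) : ℕ) : ℝ)⁻¹ := by
      rw [← nsmul_eq_mul, ← sum_const]
      exact sum_congr rfl fun T hT => by rw [(mem_own.1 hT).1.2]
    have h1 : ((t e).centralBinom : ℝ) ≤ 2 * #(own e) := by
      exact_mod_cast hS.centralBinom_le (ht e)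
    have h2 : (4 : ℝ) ^ N * N.choose (t e) ≤ 5 ^ N * (t e).centralBinom := by
      exact_mod_cast four_pow_mul_choose_le N (t e)
    have hpos : (0 : ℝ) < N.choose (t e) := by
      have : #(S e) ≤ N := card_le_univ _
      have := ht e
      exact_mod_cast Nat.choose_pos (by omega)
    rw [hsum, div_pow, ← div_eq_mul_inv, div_div, div_le_div_iff₀ (by positivity) hpos]
    nlinarith [pow_pos (show (0 : ℝ) < 5 by norm_num) N]
  have hle : (Fintype.card ι : ℝ) * ((4 / 5 : ℝ) ^ N / 2) ≤ 1 := by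
    refine le_trans ?_ hlym
    rw [← nsmul_eq_mul, ← card_univ, ← sum_const]
    exact sum_le_sum fun e _ => hterm e
  rw [div_pow, div_div, mul_div_assoc', div_le_one (by positivity)] at hle
  have : (Fintype.card ι : ℝ) * 4 ^ N ≤ 2 * 5 ^ N := by linarith
  exact_mod_cast this

theorem IsCoverFree.card_le_five_fourths_pow [Fintype ι] [Fintype α] {S : ι → Finset α}
    (hS : IsCoverFree 2 S) :
    (Fintype.card ι : ℝ) ≤ 5 / 2 * (5 / 4) ^ Fintype.card α := by
  classical
  -- The dummy point `none` makes all sets even.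
  set S' : ι → Finset (Option α) := fun e =>
    if Even #(S e) then (S e).map Function.Embedding.some else insertNone (S e) with hS'
  have hmem : ∀ e x, some x ∈ S' e ↔ x ∈ S e := by
    intro e x
    by_cases h : Even #(S e) <;> simp [hS', h]
  have hcf : IsCoverFree 2 S' := by
    intro e P he hP hsub
    refine hS e P he hP fun x hx => ?_
    obtain ⟨f, hf, hxf⟩ := mem_biUnion.1 (hsub ((hmem e x).2 hx))
    exact mem_biUnion.2 ⟨f, hf, (hmem f x).1 hxf⟩
  have heven : ∀ e, Even #(S' e) := by
    intro e
    by_cases h : Even #(S e)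
    · simp [hS', h]
    · simp only [hS', h, if_false, card_insertNone]
      exact (Nat.not_even_iff_odd.1 h).add_one
  have h := hcf.card_mul_four_pow_le_of_even heven
  rw [Fintype.card_option] at h
  have h' : (Fintype.card ι : ℝ) * 4 ^ (Fintype.card α + 1) ≤ 2 * 5 ^ (Fintype.card α + 1) := by
    exact_mod_cast h
  rw [div_pow, ← mul_div_assoc, le_div_iff₀ (by positivity)]
  rw [pow_succ, pow_succ] at h'
  linarith

/-! ### Families in which no set is covered by `r` others -/

/-- If every small subset of `S e` lies in another member, then a subset of `S e` can be cut into
small pieces and covered by other members. -/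
theorem exists_cover_of_forall_not_isOwn {S : ι → Finset α} {e : ι} {t : ℕ}
    (h : ∀ T, #T ≤ t → ¬ IsOwn S e T) (k : ℕ) (D : Finset α) (hD : D ⊆ S e) (hk : #D ≤ t * k) :
    ∃ P : Finset ι, #P ≤ k ∧ e ∉ P ∧ D ⊆ P.biUnion S := by
  classical
  induction k generalizing D with
  | zero => exact ⟨∅, by simp, by simp, by simpa using hk⟩
  | succ k ih =>
    obtain ⟨T, hTD, hT⟩ := exists_subset_card_eq (min_le_right t #D)
    have hTown := h T (hT.trans_le (min_le_left _ _))
    simp only [IsOwn, hTD.trans hD, true_and, not_forall, not_not] at hTown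
    obtain ⟨f, hf, hTf⟩ := hTown
    obtain ⟨P, hP, heP, hDP⟩ := ih (D \ T) (sdiff_subset.trans hD) (by
      rw [card_sdiff_of_subset hTD, hT]
      rw [mul_add, mul_one] at hk
      omega)
    refine ⟨insert f P, (card_insert_le _ _).trans (by omega), by simp [heP, hf.symm], ?_⟩
    intro x hx
    rw [mem_biUnion]
    by_cases hxT : x ∈ T
    · exact ⟨f, mem_insert_self _ _, hTf hxT⟩
    · obtain ⟨g, hg, hxg⟩ := mem_biUnion.1 (hDP (mem_sdiff.2 ⟨hx, hxT⟩))
      exact ⟨g, mem_insert_of_mem hg, hxg⟩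

/-- Each of the members that have no small own subset contains many points outside the members
that were counted before it. -/
theorem IsCoverFree.sum_le_card_biUnion {S : ι → Finset α} {r t : ℕ} (hS : IsCoverFree r S)
    (Q : Finset ι) (hQ : ∀ e ∈ Q, ∀ T, #T ≤ t → ¬ IsOwn S e T) (hr : #Q ≤ r + 1) :
    ∑ j ∈ range #Q, (t * (r - j) + 1) ≤ #(Q.biUnion S) := by
  classical
  induction Q using Finset.induction_on with
  | empty => simp
  | insert e Q he ih =>
    rw [card_insert_of_notMem he] at hr ⊢
    rw [sum_range_succ, biUnion_insert, ← sdiff_union_self_eq_union,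
      card_union_of_disjoint sdiff_disjoint]
    have ih' := ih (fun f hf => hQ f (mem_insert_of_mem hf)) (by omega)
    -- Otherwise `r - #Q` other members cover the part of `S e` that `Q` leaves out.
    have hlt : t * (r - #Q) < #(S e \ Q.biUnion S) := by
      by_contra! hle
      obtain ⟨P, hP, heP, hsub⟩ := exists_cover_of_forall_not_isOwn
        (hQ e (mem_insert_self _ _)) (r - #Q) _ sdiff_subset hle
      refine hS e (P ∪ Q) (by simp [heP, he]) ((card_union_le _ _).trans (by omega)) ?_
      rw [union_biUnion]
      intro x hx
      by_cases hxQ : x ∈ Q.biUnion S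
      · exact mem_union_right _ hxQ
      · exact mem_union_left _ (hsub (mem_sdiff.2 ⟨hx, hxQ⟩))
    omega

theorem sum_range_mul_sub_add_one (r t : ℕ) :
    ∑ j ∈ range (r + 1), (t * (r - j) + 1) = t * (r + 1).choose 2 + (r + 1) := by
  have h := sum_range_reflect (fun j => t * j + 1) (r + 1)
  simp only [Nat.add_sub_cancel] at h
  rw [show ∑ j ∈ range (r + 1), (t * (r - j) + 1) = ∑ j ∈ range (r + 1), (t * j + 1) from ?_]
  · rw [sum_add_distrib, ← mul_sum, sum_range_id, Nat.choose_two_right]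
    simp
  · rw [← h]

/-- **Füredi's bound.** At most `r` members have no own subset of size at most `t`; the others are
determined by one such subset. -/
theorem IsCoverFree.card_le_add_card_filter [Fintype ι] [Fintype α] {S : ι → Finset α} {r t : ℕ}
    (hS : IsCoverFree r S) (ht : Fintype.card α < t * (r + 1).choose 2 + (r + 1)) :
    Fintype.card ι ≤ r + #{T : Finset α | #T ≤ t} := by
  classical
  set F : Finset ι := {e | ∀ T, #T ≤ t → ¬ IsOwn S e T} with hF
  have h1 : #F ≤ r := by
    by_contra! hlt
    obtain ⟨Q, hQF, hQ⟩ := exists_subset_card_eq (n := r + 1) hlt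
    have h := hS.sum_le_card_biUnion (t := t) Q (fun e he => by
      have := hQF he
      simpa [hF] using this) hQ.le
    rw [hQ, sum_range_mul_sub_add_one] at h
    have := card_le_univ (Q.biUnion S)
    omega
  have h2 : #(univ \ F) ≤ #{T : Finset α | #T ≤ t} := by
    have hex : ∀ e, ∃ T, e ∉ F → #T ≤ t ∧ IsOwn S e T := by
      intro e
      by_cases he : e ∈ F
      · exact ⟨∅, fun h => absurd he h⟩
      · have he' := he
        simp only [hF, mem_filter, mem_univ, true_and, not_forall, not_not] at he'
        obtain ⟨T, hT, hT'⟩ := he'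
        exact ⟨T, fun _ => ⟨hT, hT'⟩⟩
    choose T hT using hex
    refine card_le_card_of_injOn T (fun e he => ?_) fun e he f hf hef => ?_
    · simp only [coe_sdiff, Set.mem_sdiff, mem_coe] at he
      simpa using (hT e he.2).1
    · simp only [coe_sdiff, Set.mem_sdiff, mem_coe] at he hf
      exact (hT e he.2).2.eq_of_subset (hT f hf.2).2 hef.subset
  have h3 := card_sdiff_add_card_eq_card (subset_univ F)
  rw [card_univ] at h3
  omega

theorem two_mul_add_one_choose_two (w : ℕ) : 2 * (w + 1).choose 2 = w ^ 2 + w := by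
  rw [Nat.choose_two_right, Nat.mul_div_cancel' (Nat.even_mul_pred_self _).two_dvd]
  simp only [Nat.add_sub_cancel]
  ring

/-- Füredi's bound with `t = 1`, in the case that fewer than `w ^ 2 / 4` points are available. -/
theorem IsCoverFree.sq_le_four_mul_card [Fintype ι] [Fintype α] {S : ι → Finset α} {w : ℕ}
    (hS : IsCoverFree w S) (hw : 2 ≤ w) (hm : (w + 1).choose 2 < Fintype.card ι) :
    w ^ 2 ≤ 4 * Fintype.card α := by
  have hK := two_mul_add_one_choose_two w
  by_contra! hlt
  have h := hS.card_le_add_card_filter (t := 1) (by omega)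
  have h1 := card_filter_card_le_one (α := α)
  nlinarith

/-- Füredi's bound with the least `t` for which `n < t * (w + 1).choose 2`. -/
theorem IsCoverFree.log_card_le [Fintype ι] [Fintype α] {S : ι → Finset α} {w : ℕ}
    (hS : IsCoverFree w S) (hw : 2 ≤ w) (hm : (w + 1).choose 2 < Fintype.card ι) :
    Real.log (Fintype.card ι) ≤ 22 * (Fintype.card α * Real.log w / (w : ℝ) ^ 2) := by
  set m := Fintype.card ι
  set n := Fintype.card α with hn
  set K := (w + 1).choose 2 with hKdef
  have hK : 2 * K = w ^ 2 + w := two_mul_add_one_choose_two w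
  have hsq : w ^ 2 ≤ 4 * n := hS.sq_le_four_mul_card hw hm
  have hKpos : 0 < K := by nlinarith
  have hcard := hS.card_le_add_card_filter (t := n / K + 1) (by
    have := Nat.lt_mul_div_succ n hKpos
    rw [mul_comm] at this
    exact this.trans_le (Nat.le_add_right _ _))
  set t := n / K + 1 with ht
  have hwR : (2 : ℝ) ≤ w := by exact_mod_cast hw
  have hcard' : (m : ℝ) ≤ w + ((w : ℝ) ^ 2) ^ t * (1 + ((w : ℝ) ^ 2)⁻¹) ^ n := by
    have h := card_filter_card_le (α := α) (x := (w : ℝ) ^ 2) (by nlinarith) t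
    have h' : (m : ℝ) ≤ w + #{T : Finset α | #T ≤ t} := by exact_mod_cast hcard
    linarith
  set L := Real.log w with hL
  set q : ℝ := n / (w : ℝ) ^ 2 with hq
  have hw2 : (0 : ℝ) < (w : ℝ) ^ 2 := by positivity
  have hq4 : 1 / 4 ≤ q := by
    have : ((w : ℝ) ^ 2) ≤ 4 * n := by exact_mod_cast hsq
    rw [hq, le_div_iff₀ hw2]
    linarith
  have hL2 : Real.log 2 ≤ L := Real.log_le_log (by norm_num) hwR
  have hlog2 := Real.log_two_gt_d9
  have htq : (t : ℝ) ≤ 6 * q := by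
    -- Here `K ≥ w ^ 2 / 2`; below, the `1` in the definition of `t` is at most `4 * q`.
    have h1 : ((n / K : ℕ) : ℝ) ≤ 2 * q := by
      refine Nat.cast_div_le.trans ?_
      have hK' : (2 : ℝ) * K = (w : ℝ) ^ 2 + w := by exact_mod_cast hK
      have hKR : (0 : ℝ) < K := by exact_mod_cast hKpos
      rw [hq, mul_div_assoc', div_le_div_iff₀ hKR hw2]
      have : (0 : ℝ) ≤ n := by positivity
      nlinarith
    rw [ht]
    push_cast
    linarith
  have hexp : ((w : ℝ) ^ 2) ^ t * (1 + ((w : ℝ) ^ 2)⁻¹) ^ n ≤ Real.exp (2 * t * L + q) := by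
    rw [Real.exp_add]
    refine mul_le_mul (le_of_eq ?_) ?_ (by positivity) (by positivity)
    · rw [← Real.exp_log (show (0 : ℝ) < w by linarith), ← hL, ← Real.exp_nat_mul,
        ← Real.exp_nat_mul]
      congr 1
      push_cast
      ring
    · have h1 : 1 + ((w : ℝ) ^ 2)⁻¹ ≤ Real.exp ((w : ℝ) ^ 2)⁻¹ := by
        rw [add_comm]
        exact Real.add_one_le_exp _
      calc (1 + ((w : ℝ) ^ 2)⁻¹) ^ n ≤ Real.exp ((w : ℝ) ^ 2)⁻¹ ^ n :=
            pow_le_pow_left₀ (by positivity) h1 n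
        _ = Real.exp q := by rw [← Real.exp_nat_mul, hq, div_eq_mul_inv]
  -- As `m > w * (w + 1) / 2`, the summand `w` is at most `2 * m / 3`.
  have hm3 : (m : ℝ) ≤ 3 * Real.exp (2 * t * L + q) := by
    have : 3 * w ≤ 2 * m := by nlinarith
    have : (3 : ℝ) * w ≤ 2 * m := by exact_mod_cast this
    linarith
  have hmpos : (0 : ℝ) < m := by
    have : 0 < m := by omega
    exact_mod_cast this
  have hlogm := Real.log_le_log hmpos hm3
  rw [Real.log_mul (by norm_num) (Real.exp_pos _).ne', Real.log_exp] at hlogm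
  have hlog3 : Real.log 3 ≤ 2 * Real.log 2 := by
    rw [← Real.log_rpow (by norm_num)]
    exact Real.log_le_log (by norm_num) (by norm_num)
  have hgoal : 22 * (n * L / (w : ℝ) ^ 2) = 22 * (q * L) := by
    rw [hq]
    ring
  rw [hgoal]
  have hL0 : 0 < L := by linarith
  have e1 : 2 * t * L ≤ 12 * (q * L) := by nlinarith
  have e2 : q ≤ 3 / 2 * (q * L) := by nlinarith
  have e3 : L ≤ 4 * (q * L) := by nlinarith
  linarith

end CoverFree

/-! ### Coverings of graphs -/

section Covering

variable {V : Type*} {G : SimpleGraph V}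

theorem SimpleGraph.exists_mem_notMem_of_mem_edgeSet {e f : Sym2 V} (hf : f ∈ G.edgeSet)
    (hne : f ≠ e) : ∃ x ∈ f, x ∉ e := by
  induction f with
  | h x y =>
    by_contra! h
    exact hne ((Sym2.mem_and_mem_iff (G.ne_of_adj hf)).1 ⟨h x (by simp), h y (by simp)⟩).symm

open Classical in
/-- The indices of the sets that contain both ends of `e`. -/
noncomputable def indexSet {n : ℕ} (A : Fin n → Set V) (e : G.edgeSet) : Finset (Fin n) :=
  {j | ∀ x ∈ (e : Sym2 V), x ∈ A j}

theorem IsCovering.isCoverFree [Finite V] {w n : ℕ} {A : Fin n → Set V} (hA : IsCovering G w 1 A)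
    (hV : w + 2 ≤ Nat.card V) : IsCoverFree w (indexSet (G := G) A) := by
  classical
  have := Fintype.ofFinite V
  rw [Nat.card_eq_fintype_card] at hV
  rintro ⟨e, he⟩ P heP hP hsub
  induction e with
  | h u v =>
    have hex : ∀ f : G.edgeSet, ∃ x, f ∈ P → x ∈ (f : Sym2 V) ∧ x ∉ s(u, v) := by
      intro f
      by_cases hf : f ∈ P
      · obtain ⟨x, hx, hx'⟩ := G.exists_mem_notMem_of_mem_edgeSet (e := s(u, v)) f.2 (by
          rintro h
          exact heP (by rwa [show (⟨s(u, v), he⟩ : G.edgeSet) = f from Subtype.ext h.symm]))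
        exact ⟨x, fun _ => ⟨hx, hx'⟩⟩
      · exact ⟨u, fun h => absurd h hf⟩
    choose x hx using hex
    -- The chosen ends are completed to a set of exactly `w` vertices.
    obtain ⟨W, hPW, hW, hWw⟩ := exists_subsuperset_card_eq (s := P.image x) (t := univ \ {u, v})
      (n := w) (by
        intro y hy
        obtain ⟨f, hf, rfl⟩ := mem_image.1 hy
        simpa using (hx f hf).2) (card_image_le.trans hP) (by
        rw [card_sdiff_of_subset (subset_univ _), card_univ]
        have := card_le_two (a := u) (b := v)
        omega)
    have hu : u ∉ W := fun h => by simpa using hW h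
    have hv : v ∉ W := fun h => by simpa using hW h
    have hpos := hA u v he W hWw hu hv
    obtain ⟨j, hju, hjv, hj⟩ := Set.nonempty_of_ncard_ne_zero (by omega :
      {j : Fin n | u ∈ A j ∧ v ∈ A j ∧ ∀ x ∈ W, x ∉ A j}.ncard ≠ 0)
    have hje : j ∈ indexSet (G := G) A ⟨s(u, v), he⟩ := by
      simp [indexSet, hju, hjv]
    obtain ⟨f, hf, hjf⟩ := mem_biUnion.1 (hsub hje)
    simp only [indexSet, mem_filter, mem_univ, true_and] at hjf
    exact hj (x f) (hPW (mem_image_of_mem x hf)) (hjf _ (hx f hf).1)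

theorem SimpleGraph.add_two_le_card_of_choose_lt [Finite V] {w : ℕ}
    (h : (w + 1).choose 2 < G.edgeSet.ncard) : w + 2 ≤ Nat.card V := by
  classical
  have := Fintype.ofFinite V
  have h1 := G.card_edgeFinset_le_card_choose_two
  rw [SimpleGraph.edgeFinset, ← Set.ncard_eq_toFinset_card'] at h1
  rw [Nat.card_eq_fintype_card]
  by_contra! hlt
  have := Nat.choose_le_choose 2 (show Fintype.card V ≤ w + 1 by omega)
  omega

theorem SimpleGraph.exists_isCoverFree [Finite V] {w : ℕ}
    (h : (w + 1).choose 2 < G.edgeSet.ncard) :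
    ∃ S : G.edgeSet → Finset (Fin (keyPoolNumber G w 1)), IsCoverFree w S := by
  obtain ⟨A, hA⟩ := keyPoolNumber_spec G w 1
  exact ⟨_, hA.isCoverFree (SimpleGraph.add_two_le_card_of_choose_lt h)⟩

/-- For `m ≤ 1` there may be too few vertices for the covering condition to say anything, but then
the logarithm vanishes (for `m = 0` by the convention `log 0 = 0`). -/
theorem logb_ncard_edgeSet_le_keyPoolNumber [Finite V] (G : SimpleGraph V) :
    Real.logb 2 (G.edgeSet.ncard : ℝ) ≤ (keyPoolNumber G 1 1 : ℝ) := by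
  classical
  have := Fintype.ofFinite G.edgeSet
  rcases le_or_gt G.edgeSet.ncard 1 with h | h
  · have : Real.logb 2 (G.edgeSet.ncard : ℝ) = 0 := by
      interval_cases G.edgeSet.ncard <;> simp
    rw [this]
    positivity
  · obtain ⟨S, hS⟩ := G.exists_isCoverFree (w := 1) (by simpa using h)
    have hle := hS.card_le_two_pow le_rfl
    rw [Fintype.card_fin, ← Nat.card_eq_fintype_card, Nat.card_coe_set_eq] at hle
    rw [Real.logb_le_iff_le_rpow (by norm_num) (by exact_mod_cast (by omega)), Real.rpow_natCast]
    exact_mod_cast hle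

/-- The summand `log 3` takes care of the graphs with at most three edges, which may have too few
vertices. -/
theorem log_ncard_edgeSet_le_keyPoolNumber_two [Finite V] (G : SimpleGraph V) :
    Real.log (G.edgeSet.ncard : ℝ) ≤ keyPoolNumber G 2 1 * Real.log 1.25 + Real.log 3 := by
  classical
  have := Fintype.ofFinite G.edgeSet
  have hlog : 0 < Real.log 1.25 := Real.log_pos (by norm_num)
  rcases Nat.eq_zero_or_pos G.edgeSet.ncard with h0 | h0
  · rw [h0, Nat.cast_zero, Real.log_zero]
    have := Real.log_nonneg (show (1 : ℝ) ≤ 3 by norm_num)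
    positivity
  have h0' : (0 : ℝ) < G.edgeSet.ncard := by exact_mod_cast h0
  rw [← Real.log_pow, ← Real.log_mul (by positivity) (by norm_num)]
  refine Real.log_le_log h0' ?_
  rcases le_or_gt G.edgeSet.ncard 3 with h | h
  · have h' : (G.edgeSet.ncard : ℝ) ≤ 3 := by exact_mod_cast h
    have := one_le_pow₀ (show (1 : ℝ) ≤ 1.25 by norm_num) (n := keyPoolNumber G 2 1)
    linarith
  · obtain ⟨S, hS⟩ := G.exists_isCoverFree (w := 2) (by simpa [Nat.choose] using h)
    have hle := hS.card_le_five_fourths_pow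
    rw [Fintype.card_fin, ← Nat.card_eq_fintype_card, Nat.card_coe_set_eq] at hle
    have hpos : (0 : ℝ) < (5 / 4) ^ keyPoolNumber G 2 1 := by positivity
    rw [show (1.25 : ℝ) = 5 / 4 by norm_num]
    linarith

theorem log_ncard_edgeSet_le_keyPoolNumber [Finite V] (G : SimpleGraph V) {w : ℕ} (hw : 2 ≤ w)
    (h : (w + 1).choose 2 < G.edgeSet.ncard) :
    Real.log (G.edgeSet.ncard : ℝ) ≤
      22 * (keyPoolNumber G w 1 * Real.log w / (w : ℝ) ^ 2) := by
  classical
  have := Fintype.ofFinite G.edgeSet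
  obtain ⟨S, hS⟩ := G.exists_isCoverFree h
  have hcard : Fintype.card G.edgeSet = G.edgeSet.ncard := by
    rw [← Nat.card_eq_fintype_card, Nat.card_coe_set_eq]
  have hle := hS.log_card_le hw (by rwa [hcard])
  rwa [hcard, Fintype.card_fin] at hle

end Covering

theorem mainTheorem7 :
    (∀ (V : Type u) [Finite V] (G : SimpleGraph V),
      2 / (1 + Real.logb 2 (Real.exp 1)) * Real.logb 2 (G.edgeSet.ncard : ℝ) ≤
        (keyPoolNumber G 1 1 : ℝ)) ∧
    (∃ C : ℝ, ∀ (V : Type u) [Finite V] (G : SimpleGraph V),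
      1 / Real.log 1.25 * Real.log (G.edgeSet.ncard : ℝ) ≤ (keyPoolNumber G 2 1 : ℝ) + C) ∧
    (∃ c : ℝ, 0 < c ∧ ∀ w : ℕ, 2 ≤ w → ∀ (V : Type u) [Finite V] (G : SimpleGraph V),
      (w + 1).choose 2 < G.edgeSet.ncard →
        c * ((w : ℝ) ^ 2 / Real.log (w : ℝ)) * Real.log (G.edgeSet.ncard : ℝ) ≤
          (keyPoolNumber G w 1 : ℝ)) := by
  refine ⟨fun V _ G => ?_, ⟨Real.log 3 / Real.log 1.25, fun V _ G => ?_⟩,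
    ⟨1 / 22, by norm_num, fun w hw V _ G hm => ?_⟩⟩
  · -- The factor is at most `1`, because `2 ≤ exp 1`.
    have h1 : 1 ≤ Real.logb 2 (Real.exp 1) := by
      rw [Real.le_logb_iff_rpow_le (by norm_num) (Real.exp_pos 1), Real.rpow_one]
      linarith [Real.add_one_le_exp (1 : ℝ)]
    have h2 : 2 / (1 + Real.logb 2 (Real.exp 1)) ≤ 1 := by
      rw [div_le_one (by linarith)]
      linarith
    have h3 : 0 ≤ Real.logb 2 (G.edgeSet.ncard : ℝ) :=
      div_nonneg (Real.log_natCast_nonneg _) (Real.log_nonneg (by norm_num))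
    exact (mul_le_of_le_one_left h3 h2).trans (logb_ncard_edgeSet_le_keyPoolNumber G)
  · have hlog : 0 < Real.log 1.25 := Real.log_pos (by norm_num)
    have h := log_ncard_edgeSet_le_keyPoolNumber_two G
    rw [one_div, inv_mul_eq_div, div_le_iff₀ hlog, add_mul, div_mul_cancel₀ _ hlog.ne']
    exact h
  · have hlog : 0 < Real.log w := Real.log_pos (by exact_mod_cast (by omega))
    have hw2 : (0 : ℝ) < (w : ℝ) ^ 2 := by positivity
    have h := log_ncard_edgeSet_le_keyPoolNumber G hw hm
    calc (1 / 22 * ((w : ℝ) ^ 2 / Real.log w) * Real.log (G.edgeSet.ncard : ℝ) : ℝ)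
        ≤ 1 / 22 * ((w : ℝ) ^ 2 / Real.log w) *
            (22 * (keyPoolNumber G w 1 * Real.log w / (w : ℝ) ^ 2)) := by gcongr
      _ = (keyPoolNumber G w 1 : ℝ) := by field_simp
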